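/- **Setting.** Let $X$ and $Y$ be metric spaces. A (local) semiflow on a space $Z$ is a partially defined map $(t,z)\mapsto z\,\pi\,t$, $t\in\mathbb{R}^+=[0,\infty)$, with open domain in $\mathbb{R}^+\times Z$, continuous on its domain, with $z\,\pi\,0=z$ and $z\,\pi\,(s+t)=(z\,\pi\,s)\,\pi\,t$ (one side being defined iff the other is). Let $y\mapsto y^t$ be a global semiflow on $Y$ and let $\pi=(\cdot^t,\Phi)$ be a skew-product semiflow on $Y\times X$, i.e. $(y,x)\,\pi\,t=(y^t,\Phi(t,y,x))$ is a semiflow, undefined exactly where $\Phi$ is. For $y_0\in Y$ let $\mathcal{H}^+(y_0)=\mathrm{cl}\{y_0^t: t\ge 0\}$, let $\chi=\chi_{y_0}$ be the semiflow $(t,x)\,\chi\,s=(t+s,\Phi(s,y_0^t,x))$ on $\mathbb{R}^+\times X$, and let $r:\mathbb{R}^+\times X\to\mathcal{H}^+(y_0)\times X$, $r(t,x)=(y_0^t,x)$. Neighborhoods and interiors of subsets of $\mathcal{H}^+(y_0)\times X$ are relative to $\mathcal{H}^+(y_0)\times X$. $\mathrm{Inv}\,N$ is the set of $z\in N$ for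 which there is $u:\mathbb{R}\to N$ with $u(0)=z$ and $u(t+s)=u(t)\,\pi\,s$ for all $t\in\mathbb R$, $s\ge0$. A closed set $N\subset\mathcal{H}^+(y_0)\times X$ is an isolating neighborhood of $K$ if $K=\mathrm{Inv}\,N\subset\mathrm{int}\,N$. A set $M$ is strongly admissible if $\pi$ does not explode in $M$ (there are no $z,t$ with $z\,\pi\,[0,t[\,\subset M$ and $z\,\pi\,t$ undefined) and, whenever $z_n\,\pi\,[0,t_n]\subset M$ and $t_n\to\infty$, the sequence $(z_n\,\pi\,t_n)_n$ has a convergent subsequence. (A closed set for which the latter holds for all sequences $t_n\in\mathbb{R}^+$ is strongly admissible in this sense.) A pair $(N_1,N_2)$ of closed sets $N_2\subset N_1\subset\mathbb{R}^+\times X$ is an *index pair for $(y_0,K)$*, where $K\subset\mathcal{H}^+(y_0)\times X$, if * whenever $z\in N_1$ and $z\,\chi\,t\notin N_1$ (or is undefined) for some $t\ge 0$, then $z\,\chi\,s\in N_2$ for some $s\in[0,t]$; * whenever $z\in N_2$ and $z\,\chi\,t\notin N_2$ (or is undefined) for some $t\ge 0$, then $z\,\chi\,s\in(\mathbb{R}^+\times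 X)\setminus N_1$ for some $s\in[0,t]$; * there is a strongly admissible isolating neighborhood $N$ of $K$ in $\mathcal{H}^+(y_0)\times X$ with $N_1\setminus N_2\subset r^{-1}(N)$; * there is a neighborhood $W$ of $K$ in $\mathcal{H}^+(y_0)\times X$ with $r^{-1}(W)\subset N_1\setminus N_2$. For sets $A,B$ in a topological space, $(A/B,B)$ is the pointed space obtained from $A$ by collapsing $A\cap B$ to the base point, with the quotient topology; if $A\cap B=\emptyset$, an isolated base point is added to $A$. **Corollary.** Let $y_0\in Y$ and $K\subset\mathcal{H}^+(y_0)\times X$. If $(N_1,N_2)$ and $(M_1,M_2)$ are index pairs for $(y_0,K)$, then the pointed spaces $(N_1/N_2,N_2)$ and $(M_1/M_2,M_2)$ are pointed homotopy equivalent. Consequently the homotopy index of $(y_0,K)$ is well defined: if there is an index pair for $(y_0,K)$, there is exactly one pointed homotopy type $h$ such that $(N_1/N_2,N_2)$ has pointed homotopy type $h$ for every index pair $(N_1,N_2)$ for $(y_0,K)$. -/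

import Mathlib

open scoped NNReal Topology
open Set Filter

namespace NonautonomousConley

universe u v

/-! ### Semiflows

The symbol `◇` (undefined) is `none`. It is never a member of a set of the phase space,
and it is mapped to itself (`Option.bind`). -/

/-- A (local) semiflow on `Z`, defined on an open subset of `ℝ₊ × Z` and continuous there. -/
structure LocalSemiflow (Z : Type*) [TopologicalSpace Z] where
  toFun : ℝ≥0 → Z → Option Z
  isOpen_dom : IsOpen {p : ℝ≥0 × Z | (toFun p.1 p.2).isSome}
  continuousOn_dom : ContinuousOn (fun p : ℝ≥0 × Z => (toFun p.1 p.2).getD p.2)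
    {p : ℝ≥0 × Z | (toFun p.1 p.2).isSome}
  map_zero : ∀ z, toFun 0 z = some z
  map_add : ∀ (s t : ℝ≥0) (z : Z), toFun (s + t) z = (toFun s z).bind (toFun t)

namespace LocalSemiflow

variable {Z : Type*} [TopologicalSpace Z]

/-- `z π t ∈ S`, which includes that `z π t` is defined. -/
def MapsIn (π : LocalSemiflow Z) (t : ℝ≥0) (z : Z) (S : Set Z) : Prop :=
  ∃ w, π.toFun t z = some w ∧ w ∈ S

/-- The largest invariant subset of `N`: the points of `N` through which there is a solution
`ℝ → N` of `π`. -/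
def inv (π : LocalSemiflow Z) (N : Set Z) : Set Z :=
  {z | z ∈ N ∧ ∃ w : ℝ → Z, (∀ (t : ℝ) (s : ℝ≥0), π.toFun s (w t) = some (w (t + s))) ∧
    (∀ t, w t ∈ N) ∧ w 0 = z}

/-- `π` explodes in `N` if `z π [0,t[ ⊆ N` and `z π t = ◇` for some `z` and `t`. -/
def ExplodesIn (π : LocalSemiflow Z) (N : Set Z) : Prop :=
  ∃ (z : Z) (t : ℝ≥0), (∀ s < t, π.MapsIn s z N) ∧ π.toFun t z = none

/-- Strong admissibility: `π` does not explode in `M`, and whenever `zₙ π [0,tₙ] ⊆ M` and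
`tₙ → ∞`, the sequence of endpoints `zₙ π tₙ` has a convergent subsequence. -/
def StronglyAdmissible (π : LocalSemiflow Z) (M : Set Z) : Prop :=
  ¬ π.ExplodesIn M ∧
  ∀ (z : ℕ → Z) (t : ℕ → ℝ≥0) (w : ℕ → Z), Tendsto t atTop atTop →
    (∀ n, ∀ s ≤ t n, π.MapsIn s (z n) M) → (∀ n, π.toFun (t n) (z n) = some (w n)) →
    ∃ (l : Z) (φ : ℕ → ℕ), StrictMono φ ∧ Tendsto (w ∘ φ) atTop (𝓝 l)

/-- For a closed set, the compactness condition without the restriction `tₙ → ∞` implies strong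
admissibility; in particular it rules out explosions. -/
theorem stronglyAdmissible_of_forall_seq (π : LocalSemiflow Z) {M : Set Z} (hM : IsClosed M)
    (h : ∀ (z : ℕ → Z) (t : ℕ → ℝ≥0) (w : ℕ → Z),
      (∀ n, ∀ s ≤ t n, π.MapsIn s (z n) M) → (∀ n, π.toFun (t n) (z n) = some (w n)) →
      ∃ (l : Z) (φ : ℕ → ℕ), StrictMono φ ∧ Tendsto (w ∘ φ) atTop (𝓝 l)) :
    π.StronglyAdmissible M := by
  refine ⟨?_, fun z t w _ => h z t w⟩
  rintro ⟨z, t, hz, ht⟩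
  have ht0 : 0 < t := by
    rcases eq_or_lt_of_le (zero_le : 0 ≤ t) with h0 | h0
    · rw [← h0, π.map_zero] at ht
      cases ht
    · exact h0
  obtain ⟨s, -, hst, hs⟩ := exists_seq_strictMono_tendsto' ht0
  have hst' : ∀ n, s n < t := fun n => (hst n).2
  choose w hw hwM using fun n => hz (s n) (hst' n)
  obtain ⟨l, φ, hφ, hl⟩ := h (fun _ => z) s w
    (fun n r hr => hz r (hr.trans_lt (hst' n))) hw
  have hlM : l ∈ M := hM.mem_of_tendsto hl (Eventually.of_forall fun n => hwM _)
  have hdom : {p : ℝ≥0 × Z | (π.toFun p.1 p.2).isSome} ∈ 𝓝 ((0 : ℝ≥0), l) :=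
    π.isOpen_dom.mem_nhds (by simp [π.map_zero])
  have hlim : Tendsto (fun n => (t - s (φ n), w (φ n))) atTop (𝓝 ((0 : ℝ≥0), l)) := by
    refine Tendsto.prodMk_nhds ?_ hl
    have h1 : Tendsto (fun n => t - s (φ n)) atTop (𝓝 (t - t)) :=
      tendsto_const_nhds.sub (hs.comp hφ.tendsto_atTop)
    simpa using h1
  obtain ⟨n, hn⟩ := (hlim.eventually hdom).exists
  have hsum : s (φ n) + (t - s (φ n)) = t := add_tsub_cancel_of_le (hst' _).le
  have h2 := π.map_add (s (φ n)) (t - s (φ n)) z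
  rw [hsum, ht, hw] at h2
  have h3 : (π.toFun (t - s (φ n)) (w (φ n))).isSome := hn
  simp only [Option.bind_some] at h2
  rw [← h2] at h3
  cases h3

/-- A (basic) index pair relative to a semiflow. -/
structure IsBasicIndexPair (χ : LocalSemiflow Z) (N₁ N₂ : Set Z) : Prop where
  subset : N₂ ⊆ N₁
  isClosed_fst : IsClosed N₁
  isClosed_snd : IsClosed N₂
  exit : ∀ z ∈ N₁, ∀ t, ¬ χ.MapsIn t z N₁ → ∃ s ≤ t, χ.MapsIn s z N₂
  leave : ∀ z ∈ N₂, ∀ t, ¬ χ.MapsIn t z N₂ → ∃ s ≤ t, χ.MapsIn s z N₁ᶜ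

end LocalSemiflow

/-- A skew-product semiflow `π` on `Y × X`: a global semiflow `y ↦ y ^ t` on `Y` (`shift`),
together with a partially defined map `Φ` (`cocycle`) such that
`(y, x) π t = (y ^ t, Φ(t, y, x))` (undefined if `Φ(t, y, x)` is) is a semiflow. -/
structure SkewProductSemiflow (Y : Type*) (X : Type*) [TopologicalSpace Y]
    [TopologicalSpace X] where
  shift : Flow ℝ≥0 Y
  cocycle : ℝ≥0 → Y → X → Option X
  semiflow : LocalSemiflow (Y × X)
  semiflow_apply : ∀ t y x,
    semiflow.toFun t (y, x) = (cocycle t y x).map (fun x' => (shift t y, x'))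

namespace SkewProductSemiflow

variable {Y : Type*} {X : Type*} [TopologicalSpace Y] [TopologicalSpace X]

/-- The positive hull `cl {y ^ t : t ∈ ℝ₊}`. -/
def positiveHull (π : SkewProductSemiflow Y X) (y : Y) : Set Y :=
  closure (range fun t : ℝ≥0 => π.shift t y)

/-- The set `𝓗⁺(y) × X` as a subset of `Y × X`. -/
def extendedPhaseSpace (π : SkewProductSemiflow Y X) (y : Y) : Set (Y × X) :=
  π.positiveHull y ×ˢ univ

/-- The map `r : ℝ₊ × X → 𝓗⁺(y) × X`, `r (t, x) = (y ^ t, x)`, with values in `Y × X`. -/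
def r (π : SkewProductSemiflow Y X) (y : Y) (p : ℝ≥0 × X) : Y × X :=
  (π.shift p.1 y, p.2)

theorem continuous_r (π : SkewProductSemiflow Y X) (y : Y) : Continuous (π.r y) :=
  (π.shift.cont'.comp (continuous_fst.prodMk continuous_const)).prodMk continuous_snd

theorem isSome_semiflow (π : SkewProductSemiflow Y X) (t : ℝ≥0) (y : Y) (x : X) :
    (π.semiflow.toFun t (y, x)).isSome = (π.cocycle t y x).isSome := by
  rw [π.semiflow_apply, Option.isSome_map]

/-- The semiflow `χ` on `ℝ₊ × X` belonging to the evolution operator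
`Φ_y(t + s, t, x) = Φ(s, y ^ t, x)`, that is, `(t, x) χ s = (t + s, Φ_y(t + s, t, x))`. -/
def chi (π : SkewProductSemiflow Y X) (y : Y) : LocalSemiflow (ℝ≥0 × X) where
  toFun s p := (π.cocycle s (π.shift p.1 y) p.2).map (fun x' => (p.1 + s, x'))
  isOpen_dom := by
    have hc : Continuous fun q : ℝ≥0 × (ℝ≥0 × X) => (q.1, π.r y q.2) :=
      continuous_fst.prodMk ((π.continuous_r y).comp continuous_snd)
    have h := π.semiflow.isOpen_dom.preimage hc
    convert h using 1
    ext q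
    simp [r, isSome_semiflow]
  continuousOn_dom := by
    have hc : Continuous fun q : ℝ≥0 × (ℝ≥0 × X) => (q.1, π.r y q.2) :=
      continuous_fst.prodMk ((π.continuous_r y).comp continuous_snd)
    have h := π.semiflow.continuousOn_dom.comp hc.continuousOn
      (s := {q | ((π.cocycle q.1 (π.shift q.2.1 y) q.2.2).map
        (fun x' => (q.2.1 + q.1, x'))).isSome})
      (fun q hq => by simpa [r, isSome_semiflow] using hq)
    have h' : Continuous fun q : ℝ≥0 × (ℝ≥0 × X) => q.2.1 + q.1 := by fun_prop
    refine (h'.continuousOn.prodMk (continuous_snd.comp_continuousOn h)).congr ?_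
    intro q hq
    simp only [mem_ofPred_eq, Option.isSome_map] at hq
    obtain ⟨x', hx'⟩ := Option.isSome_iff_exists.1 hq
    simp [r, π.semiflow_apply, hx']
  map_zero p := by
    have h := π.semiflow.map_zero (π.shift p.1 y, p.2)
    rw [π.semiflow_apply, Option.map_eq_some_iff] at h
    obtain ⟨x', h1, h2⟩ := h
    have h3 : x' = p.2 := congrArg Prod.snd h2
    simp [h1, h3]
  map_add s t p := by
    have h := π.semiflow.map_add s t (π.shift p.1 y, p.2)
    rw [π.semiflow_apply, π.semiflow_apply] at h
    have hs : π.shift (p.1 + s) y = π.shift s (π.shift p.1 y) := by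
      rw [add_comm]; exact π.shift.map_add' s p.1 y
    have h2 := congrArg (Option.map Prod.snd) h
    rcases hx : π.cocycle s (π.shift p.1 y) p.2 with _ | x'
    · rw [hx] at h2
      simp at h2
      simp [h2]
    · rw [hx] at h2
      simp only [Option.map_map, Option.map_some, Option.bind_some, π.semiflow_apply] at h2
      have h3 : π.cocycle (s + t) (π.shift p.1 y) p.2
          = π.cocycle t (π.shift s (π.shift p.1 y)) x' := by
        simpa [Function.comp_def] using h2
      simp [h3, hs, add_assoc]

/-- `W` is a neighborhood of `K` in `𝓗⁺(y₀) × X`: `K` lies in the interior of `W` relative to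
`𝓗⁺(y₀) × X`. -/
def IsNeighborhood (π : SkewProductSemiflow Y X) (y₀ : Y) (K W : Set (Y × X)) : Prop :=
  K ⊆ W ∧ W ⊆ π.extendedPhaseSpace y₀ ∧ ∀ k ∈ K, W ∈ 𝓝[π.extendedPhaseSpace y₀] k

/-- `N` is an isolating neighborhood for `K` in `𝓗⁺(y₀) × X`: a closed subset with
`K = Inv N` in its interior relative to `𝓗⁺(y₀) × X`. -/
structure IsIsolatingNeighborhood (π : SkewProductSemiflow Y X) (y₀ : Y)
    (K N : Set (Y × X)) : Prop where
  isClosed : IsClosed N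
  isNeighborhood : π.IsNeighborhood y₀ K N
  inv_eq : K = π.semiflow.inv N

/-- `(N₁, N₂)` is a (strongly admissible) index pair for `(y₀, K)`. The third condition forces
`K` to be an isolated invariant subset of `𝓗⁺(y₀) × X`. -/
structure IsIndexPair (π : SkewProductSemiflow Y X) (y₀ : Y) (K : Set (Y × X))
    (N₁ N₂ : Set (ℝ≥0 × X)) : Prop where
  isBasicIndexPair : (π.chi y₀).IsBasicIndexPair N₁ N₂
  isolating : ∃ N, π.semiflow.StronglyAdmissible N ∧ π.IsIsolatingNeighborhood y₀ K N ∧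
    N₁ \ N₂ ⊆ π.r y₀ ⁻¹' N
  neighborhood : ∃ W, π.IsNeighborhood y₀ K W ∧ π.r y₀ ⁻¹' W ⊆ N₁ \ N₂

end SkewProductSemiflow

/-! ### Pointed spaces, pointed homotopy types, quotients -/

/-- A pointed topological space. -/
structure PointedSpace : Type (u + 1) where
  carrier : Type u
  [top : TopologicalSpace carrier]
  pt : carrier

attribute [instance] PointedSpace.top

/-- Pointed homotopy equivalence: continuous pointed maps `f : P → Q` and `g : Q → P` such that
both composites are homotopic to the identity by homotopies that fix the base point. -/
def PointedHomotopyEquivalent (P Q : PointedSpace.{u}) : Prop :=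
  ∃ (f : C(P.carrier, Q.carrier)) (g : C(Q.carrier, P.carrier)), f P.pt = Q.pt ∧ g Q.pt = P.pt ∧
    (g.comp f).HomotopicRel (ContinuousMap.id P.carrier) {P.pt} ∧
    (f.comp g).HomotopicRel (ContinuousMap.id Q.carrier) {Q.pt}

/-- Precomposition of a homotopy relative to the base point with a pointed map. -/
theorem homotopicRel_precomp {P Q R : PointedSpace.{u}} {a b : C(Q.carrier, R.carrier)}
    (h : a.HomotopicRel b {Q.pt}) (f : C(P.carrier, Q.carrier)) (hf : f P.pt = Q.pt) :
    (a.comp f).HomotopicRel (b.comp f) {P.pt} := by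
  obtain ⟨F⟩ := h
  refine ⟨⟨F.toHomotopy.compContinuousMap f, ?_⟩⟩
  intro t x hx
  have hx' : x = P.pt := hx
  subst hx'
  exact F.eq_fst t (x := f P.pt) hf

theorem pointedHomotopyEquivalent_trans {P Q R : PointedSpace.{u}}
    (h₁ : PointedHomotopyEquivalent P Q) (h₂ : PointedHomotopyEquivalent Q R) :
    PointedHomotopyEquivalent P R := by
  obtain ⟨f, g, hf, hg, hgf, hfg⟩ := h₁
  obtain ⟨f', g', hf', hg', hgf', hfg'⟩ := h₂
  refine ⟨f'.comp f, g.comp g', by simp [hf, hf'], by simp [hg, hg'], ?_, ?_⟩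
  · exact ((homotopicRel_precomp hgf' f hf).comp_continuousMap g).trans hgf
  · exact ((homotopicRel_precomp hfg g' hg').comp_continuousMap f').trans hfg'

/-- Pointed homotopy equivalence as an equivalence relation. -/
def pointedHomotopySetoid : Setoid PointedSpace.{u} where
  r := PointedHomotopyEquivalent
  iseqv :=
    { refl := fun _ => ⟨ContinuousMap.id _, ContinuousMap.id _, rfl, rfl,
        ContinuousMap.HomotopicRel.refl _, ContinuousMap.HomotopicRel.refl _⟩
      symm := fun ⟨f, g, hf, hg, hgf, hfg⟩ => ⟨g, f, hg, hf, hfg, hgf⟩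
      trans := pointedHomotopyEquivalent_trans }

/-- Pointed homotopy types. -/
def PointedHomotopyType : Type (u + 1) := Quotient pointedHomotopySetoid.{u}

/-- The pointed homotopy type of a pointed space. -/
def pointedHomotopyType (P : PointedSpace.{u}) : PointedHomotopyType.{u} :=
  Quotient.mk pointedHomotopySetoid P

/-- The points of `A ⊔ {pt}` that are collapsed in `A / B`: those of `A ∩ B`, and `pt`. -/
def collapsed {S : Type u} (A B : Set S) : Set (↥A ⊕ Unit) :=
  {p | Sum.elim (fun a : ↥A => (a : S) ∈ B) (fun _ => True) p}

/-- The equivalence relation on `A ⊔ {pt}` that collapses `(A ∩ B) ⊔ {pt}` to a point. -/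
def collapseSetoid {S : Type u} (A B : Set S) : Setoid (↥A ⊕ Unit) where
  r p q := p = q ∨ (p ∈ collapsed A B ∧ q ∈ collapsed A B)
  iseqv :=
    { refl := fun _ => Or.inl rfl
      symm := by
        rintro p q (h | h)
        · exact Or.inl h.symm
        · exact Or.inr h.symm
      trans := by
        rintro p q s (rfl | h) (rfl | h')
        · exact Or.inl rfl
        · exact Or.inr h'
        · exact Or.inr h
        · exact Or.inr ⟨h.1, h'.2⟩ }

/-- The pointed quotient space `(A / B, B)`: `A` with `A ∩ B` collapsed to the base point, with
the quotient topology. If `A ∩ B = ∅`, then an isolated base point is added to `A`. -/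
def quotientSpace {S : Type u} [TopologicalSpace S] (A B : Set S) : PointedSpace.{u} where
  carrier := Quotient (collapseSetoid A B)
  pt := Quotient.mk (collapseSetoid A B) (Sum.inr ())

end NonautonomousConley

open NonautonomousConley

/-! The homotopy equivalence is given by the flow itself. Take π-segments in the isolating
neighborhood N whose lengths tend to infinity. By strong admissibility their midpoints have a
convergent subsequence, and the limit lies on a full solution in N, hence in K
(`longLimits_subset_inv`). Since r carries χ to π, there is a T such that a χ-trajectory staying in
N₁ \ N₂ on [0, 2T] is in M₁ \ M₂ at time T, and vice versa (`exists_forall_mapsIn_of_staysIn`).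

The comparison map N₁/N₂ → M₁/M₂ sends z to z χ 3T if z stays in N₁ \ N₂ on [0, 2T] and in M₁ \ M₂
on [T, 3T], and to the base point otherwise (`exists_comparison`). Followed by its counterpart in
the other direction it is the time-6T map of the semiflow induced on N₁/N₂
(`passes_and_passes_iff`), which is homotopic to the identity (`exists_homotopy`).

Continuity rests on the two axioms of index pairs. For points of N₁, staying in N₁ \ N₂ is an open
condition, since it amounts to avoiding the closed set N₂. It becomes a closed condition once the
endpoint is confined to a closed subset of N₁ \ N₂, since N₂ can be left only by leaving N₁. -/

namespace NonautonomousConley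

universe u

/-! ### Trajectory segments of a local semiflow -/

namespace LocalSemiflow

variable {Z : Type*} [TopologicalSpace Z] (χ : LocalSemiflow Z)

/-- The trajectory of `z` is defined on `[0, t]` and stays in `S`. -/
def StaysIn (S : Set Z) (t : ℝ≥0) (z : Z) : Prop :=
  ∀ s ≤ t, χ.MapsIn s z S

/-- The endpoint `z χ t`, with junk value `z` if it is undefined. -/
def endpoint (t : ℝ≥0) (z : Z) : Z := (χ.toFun t z).getD z

variable {χ}

theorem toFun_eq_endpoint {t : ℝ≥0} {z : Z} (h : (χ.toFun t z).isSome) :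
    χ.toFun t z = some (χ.endpoint t z) := by
  obtain ⟨w, hw⟩ := Option.isSome_iff_exists.1 h
  simp [endpoint, hw]

theorem endpoint_eq {t : ℝ≥0} {z w : Z} (h : χ.toFun t z = some w) : χ.endpoint t z = w := by
  simp [endpoint, h]

theorem endpoint_zero (z : Z) : χ.endpoint 0 z = z := endpoint_eq (χ.map_zero z)

theorem mapsIn_iff {t : ℝ≥0} {z : Z} {S : Set Z} :
    χ.MapsIn t z S ↔ (χ.toFun t z).isSome ∧ χ.endpoint t z ∈ S := by
  constructor
  · rintro ⟨w, hw, hS⟩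
    exact ⟨by simp [hw], by rwa [endpoint_eq hw]⟩
  · rintro ⟨h, hS⟩
    exact ⟨_, toFun_eq_endpoint h, hS⟩

theorem MapsIn.isSome {t : ℝ≥0} {z : Z} {S : Set Z} (h : χ.MapsIn t z S) :
    (χ.toFun t z).isSome := (mapsIn_iff.1 h).1

theorem MapsIn.endpoint_mem {t : ℝ≥0} {z : Z} {S : Set Z} (h : χ.MapsIn t z S) :
    χ.endpoint t z ∈ S := (mapsIn_iff.1 h).2

theorem MapsIn.mono {t : ℝ≥0} {z : Z} {S S' : Set Z} (h : χ.MapsIn t z S) (hS : S ⊆ S') :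
    χ.MapsIn t z S' := h.imp fun _ hw => ⟨hw.1, hS hw.2⟩

theorem StaysIn.mono {t : ℝ≥0} {z : Z} {S S' : Set Z} (h : χ.StaysIn S t z) (hS : S ⊆ S') :
    χ.StaysIn S' t z := fun s hs => (h s hs).mono hS

theorem mapsIn_zero {z : Z} {S : Set Z} : χ.MapsIn 0 z S ↔ z ∈ S := by
  simp [MapsIn, χ.map_zero]

theorem mapsIn_add {s t : ℝ≥0} {z w : Z} {S : Set Z} (h : χ.toFun s z = some w) :
    χ.MapsIn (s + t) z S ↔ χ.MapsIn t w S := by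
  simp [MapsIn, χ.map_add, h]

theorem mapsIn_add_iff {s t : ℝ≥0} {z : Z} {S : Set Z} :
    χ.MapsIn (s + t) z S ↔ χ.MapsIn s z {w | χ.MapsIn t w S} := by
  rcases h : χ.toFun s z with _ | w
  · simp [MapsIn, χ.map_add, h]
  · rw [mapsIn_add h]
    simp [MapsIn, h]

theorem mapsIn_staysIn_iff {a t : ℝ≥0} {z : Z} {S : Set Z} :
    χ.MapsIn a z {w | χ.StaysIn S t w} ↔ ∀ s ≤ t, χ.MapsIn (a + s) z S := by
  constructor
  · rintro ⟨w, hw, h⟩ s hs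
    exact (mapsIn_add hw).2 (h s hs)
  · intro h
    obtain ⟨w, hw, -⟩ := mapsIn_add_iff.1 (h 0 zero_le)
    exact ⟨w, hw, fun s hs => (mapsIn_add hw).1 (h s hs)⟩

theorem MapsIn.endpoint_add {s t : ℝ≥0} {z : Z} {S : Set Z} (h : χ.MapsIn (s + t) z S) :
    χ.endpoint (s + t) z = χ.endpoint t (χ.endpoint s z) := by
  have hs := toFun_eq_endpoint (mapsIn_add_iff.1 h).isSome
  have ht := toFun_eq_endpoint h.isSome
  rw [χ.map_add, hs, Option.bind_some] at ht
  exact (endpoint_eq ht).symm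

theorem continuousOn_endpoint : ContinuousOn (fun p : ℝ≥0 × Z => χ.endpoint p.1 p.2)
    {p : ℝ≥0 × Z | (χ.toFun p.1 p.2).isSome} := χ.continuousOn_dom

theorem isOpen_mapsIn {O : Set Z} (hO : IsOpen O) :
    IsOpen {p : ℝ≥0 × Z | χ.MapsIn p.1 p.2 O} := by
  have h := continuousOn_endpoint.isOpen_inter_preimage χ.isOpen_dom hO
  convert h using 1
  ext p
  exact mapsIn_iff

theorem isOpen_staysIn {O : Set Z} (hO : IsOpen O) :
    IsOpen {p : ℝ≥0 × Z | χ.StaysIn O p.1 p.2} := by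
  rw [isOpen_iff_mem_nhds]
  rintro ⟨t, z⟩ h
  -- The time interval [0, p.1] varies with p; truncating σ at p.1 lets σ range over a fixed compact
  -- interval.
  have hc : Continuous fun q : (ℝ≥0 × Z) × ℝ≥0 => (min q.2 q.1.1, q.1.2) := by fun_prop
  have h1 : ∀ᶠ p : ℝ≥0 × Z in 𝓝 (t, z), ∀ σ ∈ Icc 0 (t + 1), χ.MapsIn (min σ p.1) p.2 O := by
    refine isCompact_Icc.eventually_forall_of_forall_eventually fun σ _ => ?_
    exact ((isOpen_mapsIn hO).preimage hc).mem_nhds (h _ (min_le_right σ t))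
  have h2 : ∀ᶠ p : ℝ≥0 × Z in 𝓝 (t, z), p.1 < t + 1 :=
    continuous_fst.continuousAt.eventually_lt continuousAt_const (by simp)
  filter_upwards [h1, h2] with p hp hpt s hs
  simpa [min_eq_left hs] using hp s ⟨zero_le, hs.trans hpt.le⟩

theorem isClosed_mapsIn {S : Type*} [TopologicalSpace S] {A : Set S} (hA : IsClosed A)
    {τ : S → ℝ≥0} {ζ : S → Z} (hτ : Continuous τ) (hζ : Continuous ζ)
    (h : ∀ s ∈ A, (χ.toFun (τ s) (ζ s)).isSome) {C : Set Z} (hC : IsClosed C) :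
    IsClosed {s | s ∈ A ∧ χ.MapsIn (τ s) (ζ s) C} := by
  have hc : ContinuousOn (fun s => χ.endpoint (τ s) (ζ s)) A :=
    continuousOn_endpoint.comp (hτ.prodMk hζ).continuousOn h
  convert hc.preimage_isClosed_of_isClosed hA hC using 1
  ext s
  refine and_congr_right fun hs => ?_
  rw [mapsIn_iff]
  exact and_iff_right (h s hs)

/-! ### Open and closed conditions from the index pair axioms -/

namespace IsBasicIndexPair

variable {N₁ N₂ : Set Z}

/-- A trajectory cannot cease to exist without first being seen outside N₁: it has to meet N₂, and
it leaves N₂ only through the complement of N₁. -/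
theorem exists_mapsIn_compl (hN : χ.IsBasicIndexPair N₁ N₂) {z : Z} (hz : z ∈ N₁) {t : ℝ≥0}
    (h : ¬ χ.MapsIn t z N₁) : ∃ s ≤ t, χ.MapsIn s z N₁ᶜ := by
  obtain ⟨s, hs, v, hv, hv2⟩ := hN.exit z hz t h
  obtain ⟨a, rfl⟩ := exists_add_of_le hs
  rw [mapsIn_add hv] at h
  obtain ⟨b, hb, hb'⟩ := hN.leave v hv2 a (fun h' => h (h'.mono hN.subset))
  exact ⟨s + b, by gcongr, (mapsIn_add hv).2 hb'⟩

theorem staysIn_compl_iff (hN : χ.IsBasicIndexPair N₁ N₂) {z : Z} (hz : z ∈ N₁) {t : ℝ≥0} :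
    χ.StaysIn N₂ᶜ t z ↔ χ.StaysIn (N₁ \ N₂) t z := by
  refine ⟨fun h s hs => ?_, fun h => h.mono fun _ hx => hx.2⟩
  have h1 : χ.MapsIn s z N₁ := by
    by_contra hn
    obtain ⟨a, ha, ha'⟩ := hN.exit z hz s hn
    exact (h a (ha.trans hs)).endpoint_mem ha'.endpoint_mem
  exact mapsIn_iff.2 ⟨h1.isSome, h1.endpoint_mem, (h s hs).endpoint_mem⟩

/-- Failure to stay is witnessed by a visit to the open set N₁ᶜ, even when the trajectory blows up,
and such a visit persists under perturbation. -/
theorem isClosed_staysIn (hN : χ.IsBasicIndexPair N₁ N₂) :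
    IsClosed {p : ℝ≥0 × Z | χ.StaysIn N₁ p.1 p.2} := by
  rw [← isOpen_compl_iff, isOpen_iff_mem_nhds]
  rintro ⟨t, z⟩ h
  obtain ⟨s, hs, hs'⟩ : ∃ s ≤ t, χ.MapsIn s z N₁ᶜ := by
    by_cases hz : z ∈ N₁
    · have h' : ∃ s ≤ t, ¬ χ.MapsIn s z N₁ := by
        by_contra! hn
        exact h hn
      obtain ⟨s, hs, hn⟩ := h'
      obtain ⟨a, ha, ha'⟩ := hN.exists_mapsIn_compl hz hn
      exact ⟨a, ha.trans hs, ha'⟩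
    · exact ⟨0, zero_le, mapsIn_zero.2 hz⟩
  -- The truncation matters if s = t: nearby p may have p.1 < s.
  have hc : Continuous fun p : ℝ≥0 × Z => (min s p.1, p.2) := by fun_prop
  have ho := (isOpen_mapsIn (χ := χ) hN.isClosed_fst.isOpen_compl).preimage hc
  filter_upwards [ho.mem_nhds (x := (t, z)) (by simpa [min_eq_left hs] using hs')] with p hp hst
  have hp' : χ.MapsIn (min s p.1) p.2 N₁ᶜ := hp
  exact hp'.endpoint_mem (hst _ (min_le_right _ _)).endpoint_mem

/-- A visit to N₂ would have to persist up to the endpoint, as leaving N₂ requires leaving N₁. -/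
theorem staysIn_diff (hN : χ.IsBasicIndexPair N₁ N₂) {z : Z} {t : ℝ≥0} (h : χ.StaysIn N₁ t z)
    (ht : χ.endpoint t z ∉ N₂) : χ.StaysIn (N₁ \ N₂) t z := by
  intro s hs
  refine mapsIn_iff.2 ⟨(h s hs).isSome, (h s hs).endpoint_mem, fun h2 => ?_⟩
  have hv := toFun_eq_endpoint (h s hs).isSome
  obtain ⟨a, rfl⟩ := exists_add_of_le hs
  obtain ⟨b, hb, hb'⟩ := hN.leave _ h2 a fun h' => ht ((mapsIn_add hv).2 h').endpoint_mem
  exact ((mapsIn_add hv).2 hb').endpoint_mem (h (s + b) (by gcongr)).endpoint_mem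

end IsBasicIndexPair

/-! ### Limits of long trajectory segments -/

/-- The limits of points `zₙ π tₙ` of trajectory segments `zₙ π [0, tₙ + rₙ] ⊆ N` with
`tₙ → ∞` and `rₙ → ∞`. -/
def longLimits (π : LocalSemiflow Z) (N : Set Z) : Set Z :=
  {l | ∃ (z : ℕ → Z) (t r : ℕ → ℝ≥0) (w : ℕ → Z), Tendsto t atTop atTop ∧
    Tendsto r atTop atTop ∧ (∀ n, π.StaysIn N (t n + r n) (z n)) ∧
    (∀ n, π.toFun (t n) (z n) = some (w n)) ∧ Tendsto w atTop (𝓝 l)}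

variable {π : LocalSemiflow Z} {N : Set Z}

theorem tendsto_endpoint {w : ℕ → Z} {l v : Z} (hw : Tendsto w atTop (𝓝 l)) {s : ℝ≥0}
    (hs : π.toFun s l = some v) : Tendsto (fun n => π.endpoint s (w n)) atTop (𝓝 v) := by
  have h := (continuousOn_endpoint (χ := π)).continuousAt
    (π.isOpen_dom.mem_nhds (x := (s, l)) (by simp [hs]))
  have h2 := h.tendsto.comp ((tendsto_const_nhds (x := s)).prodMk_nhds hw)
  simpa [endpoint_eq hs, Function.comp_def] using h2

/-- Wherever l π s is defined, it is a limit of points of N because rₙ → ∞. If it were undefined for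
some s, then π would explode in N at the first such time, which is attained because the domain is
open. -/
theorem mapsIn_of_mem_longLimits (hN : IsClosed N) (he : ¬ π.ExplodesIn N) {l : Z}
    (hl : l ∈ π.longLimits N) (s : ℝ≥0) : π.MapsIn s l N := by
  obtain ⟨z, t, r, w, -, hr, hst, hw, hwl⟩ := hl
  have key : ∀ s, π.toFun s l ≠ none → π.MapsIn s l N := by
    intro s hs
    obtain ⟨v, hv⟩ := Option.ne_none_iff_exists'.1 hs
    refine ⟨v, hv, hN.mem_of_tendsto (tendsto_endpoint hwl hv) ?_⟩
    filter_upwards [hr.eventually_ge_atTop s] with n hn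
    exact ((mapsIn_add (hw n)).1 (hst n (t n + s) (by gcongr))).endpoint_mem
  by_contra hns
  have hD : IsClosed {s | π.toFun s l = none} := by
    rw [← isOpen_compl_iff]
    convert π.isOpen_dom.preimage (show Continuous fun s : ℝ≥0 => (s, l) by fun_prop) using 1
    ext s
    simp [Option.ne_none_iff_isSome]
  have hne : {s | π.toFun s l = none}.Nonempty := ⟨s, by
    by_contra h
    exact hns (key s h)⟩
  refine he ⟨l, sInf {s : ℝ≥0 | π.toFun s l = none}, fun s hs => key s fun h => ?_,
    hD.csInf_mem hne (OrderBot.bddBelow _)⟩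
  exact notMem_of_lt_csInf hs (OrderBot.bddBelow _) h

/-- Move the cut from tₙ back to tₙ - 1 on the same segments; admissibility yields a limit l' of the
new points, and continuity gives l' π 1 = l. -/
theorem exists_longLimits_preimage [T2Space Z] (hN : IsClosed N) (ha : π.StronglyAdmissible N)
    {l : Z} (hl : l ∈ π.longLimits N) : ∃ l' ∈ π.longLimits N, π.toFun 1 l' = some l := by
  obtain ⟨z, t, r, w, ht, hr, hst, hw, hwl⟩ := hl
  -- Discard the first m terms, so that subtracting 1 is not truncated.
  obtain ⟨m, hm⟩ := (ht.eventually_ge_atTop 1).exists_forall_of_atTop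
  have hs1 : ∀ n, π.StaysIn N (t (n + m) - 1 + (r (n + m) + 1)) (z (n + m)) := fun n => by
    have h : t (n + m) - 1 + (r (n + m) + 1) = t (n + m) + r (n + m) := by
      rw [add_comm (r _), ← add_assoc, tsub_add_cancel_of_le (hm _ (by omega))]
    rw [h]
    exact hst _
  have ht1 : Tendsto (fun n => t (n + m) - 1) atTop atTop := by
    refine tendsto_atTop.2 fun b => ?_
    filter_upwards [(ht.comp (tendsto_add_atTop_nat m)).eventually_ge_atTop (b + 1)] with n hn
    exact le_tsub_of_add_le_right hn
  have hr1 : Tendsto (fun n => r (n + m) + 1) atTop atTop :=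
    tendsto_atTop_mono (fun n => le_self_add) (hr.comp (tendsto_add_atTop_nat m))
  choose v hv _ using fun n => hs1 n (t (n + m) - 1) le_self_add
  obtain ⟨l', φ, hφ, hl'⟩ := ha.2 _ _ v ht1
    (fun n s hs => hs1 n s (hs.trans le_self_add)) hv
  have hl'mem : l' ∈ π.longLimits N := ⟨fun n => z (φ n + m), fun n => t (φ n + m) - 1,
    fun n => r (φ n + m) + 1, v ∘ φ, ht1.comp hφ.tendsto_atTop, hr1.comp hφ.tendsto_atTop,
    fun n => hs1 _, fun n => hv _, hl'⟩
  obtain ⟨x, hx, -⟩ := mapsIn_of_mem_longLimits hN ha.1 hl'mem 1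
  refine ⟨l', hl'mem, ?_⟩
  rw [hx]
  congr 1
  refine tendsto_nhds_unique (tendsto_endpoint hl' hx) ?_
  refine ((hwl.comp (tendsto_add_atTop_nat m)).comp hφ.tendsto_atTop).congr fun n => ?_
  have h := π.map_add (t (φ n + m) - 1) 1 (z (φ n + m))
  rw [tsub_add_cancel_of_le (hm _ (by omega)), hw, hv, Option.bind_some] at h
  exact (endpoint_eq h.symm).symm

/-- Iterated preimages Lₙ form a backward orbit of l with unit steps. The full solution is w t = Lₖ
π (t + k), which does not depend on the choice of k ≥ -t. -/
theorem longLimits_subset_inv [T2Space Z] (hN : IsClosed N) (ha : π.StronglyAdmissible N) :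
    π.longLimits N ⊆ π.inv N := by
  intro l hl
  choose g hg hg1 using fun l : π.longLimits N => exists_longLimits_preimage hN ha l.2
  let L : ℕ → π.longLimits N := fun n => (fun l => ⟨g l, hg l⟩)^[n] ⟨l, hl⟩
  have hL : ∀ n, π.toFun 1 (L (n + 1) : Z) = some (L n : Z) := fun n => by
    simp only [L, Function.iterate_succ_apply']
    exact hg1 _
  have hdef : ∀ n s, π.MapsIn s (L n : Z) N :=
    fun n s => mapsIn_of_mem_longLimits hN ha.1 (L n).2 s
  have hstep : ∀ (j n : ℕ) (s : ℝ≥0), π.toFun (j + s) (L (n + j) : Z) = π.toFun s (L n : Z) := by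
    intro j
    induction j with
    | zero => simp
    | succ j ih =>
      intro n s
      rw [← ih n s, Nat.cast_succ, add_comm (j : ℝ≥0) 1, add_assoc, π.map_add, ← add_assoc n,
        hL, Option.bind_some]
  let w : ℝ → Z := fun t => π.endpoint (t + ⌈-t⌉₊).toNNReal (L ⌈-t⌉₊)
  have hw : ∀ (t : ℝ) (k : ℕ), ⌈-t⌉₊ ≤ k → π.toFun (t + k).toNNReal (L k : Z) = some (w t) := by
    intro t k hk
    obtain ⟨j, rfl⟩ := exists_add_of_le hk
    have h0 : 0 ≤ t + ⌈-t⌉₊ := by linarith [Nat.le_ceil (-t)]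
    have h1 : (t + ((⌈-t⌉₊ + j : ℕ) : ℝ)).toNNReal = j + (t + ⌈-t⌉₊).toNNReal := by
      rw [Nat.cast_add, ← add_assoc, Real.toNNReal_add h0 (by positivity), add_comm]
      simp
    rw [h1, hstep]
    exact toFun_eq_endpoint (hdef _ _).isSome
  have hw0 : w 0 = l := by
    have h := hw 0 0 (by simp)
    simpa [π.map_zero, L] using h.symm
  have hwN : ∀ t, w t ∈ N := fun t => (hdef _ _).endpoint_mem
  refine ⟨hw0 ▸ hwN 0, w, fun t s => ?_, hwN, hw0⟩
  have h0 : 0 ≤ t + ⌈-t⌉₊ := by linarith [Nat.le_ceil (-t)]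
  have h := hw (t + s) ⌈-t⌉₊ (Nat.ceil_mono (by simp))
  rw [add_right_comm, Real.toNNReal_add h0 s.coe_nonneg, Real.toNNReal_coe, π.map_add, hw t _ le_rfl,
    Option.bind_some] at h
  exact h

/-- Otherwise there are midpoints in E \ W of arbitrarily long segments in N; a subsequence
converges to a point of Inv N, near which E lies in W. -/
theorem exists_forall_mem_of_staysIn [T2Space Z] (hN : IsClosed N) (ha : π.StronglyAdmissible N)
    {E W : Set Z} (hW : ∀ k ∈ π.inv N, W ∈ 𝓝[E] k) :
    ∃ T : ℝ≥0, ∀ t ≥ T, ∀ z w, π.StaysIn N (t + t) z → π.toFun t z = some w → w ∈ E → w ∈ W := by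
  by_contra! h
  choose t ht z w hst hw hE hnW using fun n : ℕ => h n
  have htt : Tendsto t atTop atTop := tendsto_atTop_mono ht tendsto_natCast_atTop_atTop
  obtain ⟨l, φ, hφ, hl⟩ := ha.2 z t w htt (fun n s hs => hst n s (hs.trans le_self_add)) hw
  have hlim : l ∈ π.longLimits N := ⟨z ∘ φ, t ∘ φ, t ∘ φ, w ∘ φ, htt.comp hφ.tendsto_atTop,
    htt.comp hφ.tendsto_atTop, fun n => hst _, fun n => hw _, hl⟩
  have hl' : Tendsto (w ∘ φ) atTop (𝓝[E] l) :=
    tendsto_nhdsWithin_iff.2 ⟨hl, Eventually.of_forall fun n => hE _⟩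
  obtain ⟨n, hn⟩ := (hl'.eventually (hW l (longLimits_subset_inv hN ha hlim))).exists
  exact hnW _ hn

end LocalSemiflow

/-! ### Transfer from π to χ -/

namespace SkewProductSemiflow

variable {Y : Type*} {X : Type*} [TopologicalSpace Y] [TopologicalSpace X]
  (π : SkewProductSemiflow Y X) (y₀ : Y)

theorem semiflow_r (t : ℝ≥0) (z : ℝ≥0 × X) :
    π.semiflow.toFun t (π.r y₀ z) = ((π.chi y₀).toFun t z).map (π.r y₀) := by
  have h : π.shift (z.1 + t) y₀ = π.shift t (π.shift z.1 y₀) := by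
    rw [add_comm]; exact π.shift.map_add' t z.1 y₀
  simp [r, chi, semiflow_apply, Function.comp_def, h]

theorem r_mem_extendedPhaseSpace (z : ℝ≥0 × X) : π.r y₀ z ∈ π.extendedPhaseSpace y₀ :=
  ⟨subset_closure ⟨z.1, rfl⟩, mem_univ _⟩

theorem exists_forall_mapsIn_of_staysIn [T2Space Y] [T2Space X] {K : Set (Y × X)}
    {N₁ N₂ M₁ M₂ : Set (ℝ≥0 × X)} (hN : π.IsIndexPair y₀ K N₁ N₂)
    (hM : π.IsIndexPair y₀ K M₁ M₂) :
    ∃ T : ℝ≥0, ∀ t ≥ T, ∀ z, (π.chi y₀).StaysIn (N₁ \ N₂) (t + t) z →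
      (π.chi y₀).MapsIn t z (M₁ \ M₂) := by
  obtain ⟨N, hadm, hiso, hsub⟩ := hN.isolating
  obtain ⟨W, hWK, hW⟩ := hM.neighborhood
  obtain ⟨T, hT⟩ := LocalSemiflow.exists_forall_mem_of_staysIn hiso.isClosed hadm
    (E := π.extendedPhaseSpace y₀) (W := W) (fun k hk => hWK.2.2 k (hiso.inv_eq ▸ hk))
  refine ⟨T, fun t ht z hz => ?_⟩
  obtain ⟨w, hw, -⟩ := hz t le_self_add
  refine ⟨w, hw, hW (hT t ht (π.r y₀ z) _ (fun s hs => ?_) ?_ (π.r_mem_extendedPhaseSpace y₀ w))⟩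
  · obtain ⟨v, hv, hvN⟩ := hz s hs
    exact ⟨π.r y₀ v, by rw [semiflow_r, hv, Option.map_some], hsub hvN⟩
  · rw [semiflow_r, hw, Option.map_some]

end SkewProductSemiflow
/-! ### Maps into and out of quotient spaces -/

section Collapse

variable {Z : Type u} [TopologicalSpace Z]

open Classical in
/-- The class of `z` in `A / B`, where points outside of `A` are sent to the base point. -/
noncomputable def collapseMap (A B : Set Z) (z : Z) : (quotientSpace A B).carrier :=
  if h : z ∈ A then Quotient.mk (collapseSetoid A B) (Sum.inl ⟨z, h⟩) else (quotientSpace A B).pt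

variable {A B : Set Z}

theorem collapseMap_of_mem {z : Z} (h : z ∈ A) :
    collapseMap A B z = Quotient.mk (collapseSetoid A B) (Sum.inl ⟨z, h⟩) := dif_pos h

theorem collapseMap_eq_pt {z : Z} (h : z ∈ B) : collapseMap A B z = (quotientSpace A B).pt := by
  by_cases hA : z ∈ A
  · rw [collapseMap_of_mem hA]
    exact Quotient.sound (Or.inr ⟨h, trivial⟩)
  · exact dif_neg hA

theorem continuousOn_collapseMap : ContinuousOn (collapseMap A B) A := by
  rw [continuousOn_iff_continuous_domRestrict]
  have h : A.domRestrict (collapseMap A B) =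
      fun a => Quotient.mk (collapseSetoid A B) (Sum.inl a) :=
    funext fun a => collapseMap_of_mem a.2
  rw [h]
  exact continuous_quotient_mk'.comp continuous_inl

theorem quotientSpace_ind {p : (quotientSpace A B).carrier → Prop}
    (h : ∀ a : A, p (collapseMap A B a)) (hpt : p (quotientSpace A B).pt) (q) : p q := by
  induction q using Quotient.ind with
  | _ a =>
    rcases a with a | ⟨⟩
    · rw [← collapseMap_of_mem a.2]
      exact h a
    · exact hpt

open Classical in
/-- A map on an open subset `P` into `A \ B` extends continuously to a map into `A / B` that sends
the complement of `P` to the base point if it is proper in the sense that preimages of closed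
subsets of `A \ B` are closed. -/
theorem continuous_ite_collapseMap (hA : IsClosed A) {S : Type*} [TopologicalSpace S] {P : Set S}
    {h : S → Z} (hP : IsOpen P) (hc : ContinuousOn h P) (hmem : MapsTo h P (A \ B))
    (hcl : ∀ C, IsClosed C → C ⊆ A \ B → IsClosed {s | s ∈ P ∧ h s ∈ C}) :
    Continuous fun s => if s ∈ P then collapseMap A B (h s) else (quotientSpace A B).pt := by
  have hq : ContinuousOn (fun s => collapseMap A B (h s)) P :=
    continuousOn_collapseMap.comp hc fun s hs => (hmem hs).1
  rw [continuous_def]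
  intro V hV
  by_cases hpt : (quotientSpace A B).pt ∈ V
  · have hC : IsClosed (A ∩ collapseMap A B ⁻¹' Vᶜ) :=
      continuousOn_collapseMap.preimage_isClosed_of_isClosed hA hV.isClosed_compl
    have h' := hcl _ hC fun z hz => ⟨hz.1, fun hB => hz.2 (by rwa [collapseMap_eq_pt hB])⟩
    convert h'.isOpen_compl using 1
    ext s
    by_cases hs : s ∈ P
    · simp [hs, (hmem hs).1]
    · simp [hs, hpt]
  · convert hq.isOpen_inter_preimage hP hV using 1
    ext s
    by_cases hs : s ∈ P <;> simp [hs, hpt]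

/-- The map on `A / B` induced by `f`, with values `q₀` at the base point. -/
def quotientLift {Q : Type*} (f : A → Q) (q₀ : Q) (h : ∀ a : A, (a : Z) ∈ B → f a = q₀) :
    (quotientSpace A B).carrier → Q :=
  Quotient.lift (s := collapseSetoid A B) (Sum.elim f fun _ => q₀) <| by
    have key : ∀ p ∈ collapsed A B, Sum.elim f (fun _ => q₀) p = q₀ := by
      rintro (a | _) hp
      · exact h a hp
      · rfl
    rintro p q (rfl | ⟨hp, hq⟩)
    · rfl
    · rw [key p hp, key q hq]

theorem continuous_quotientLift {Q : Type*} [TopologicalSpace Q] {f : A → Q} {q₀ : Q}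
    {h : ∀ a : A, (a : Z) ∈ B → f a = q₀} (hf : Continuous f) :
    Continuous (quotientLift f q₀ h) :=
  Continuous.quotient_lift (hf.sumElim continuous_const) _

theorem quotientLift_collapseMap {Q : Type*} {f : A → Q} {q₀ : Q}
    (h : ∀ a : A, (a : Z) ∈ B → f a = q₀) (a : A) :
    quotientLift f q₀ h (collapseMap A B a) = f a := by
  rw [collapseMap_of_mem a.2]
  rfl

end Collapse

namespace LocalSemiflow

variable {Z : Type u} [TopologicalSpace Z] {χ : LocalSemiflow Z} {N₁ N₂ M₁ M₂ : Set Z}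

/-! ### The flow on a quotient space -/

-- The homotopy is the induced semiflow run up to time i * t, where a point falls into the base
-- point once its trajectory meets N₂.
open Classical in
theorem IsBasicIndexPair.exists_homotopy (hN : χ.IsBasicIndexPair N₁ N₂) (t : ℝ≥0) :
    ∃ F : C(unitInterval × (quotientSpace N₁ N₂).carrier, (quotientSpace N₁ N₂).carrier),
      (∀ i, F (i, (quotientSpace N₁ N₂).pt) = (quotientSpace N₁ N₂).pt) ∧
      (∀ q, F (0, q) = q) ∧
      ∀ a : N₁, F (1, collapseMap N₁ N₂ a) = if χ.StaysIn (N₁ \ N₂) t a then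
        collapseMap N₁ N₂ (χ.endpoint t a) else (quotientSpace N₁ N₂).pt := by
  let τ : unitInterval → ℝ≥0 := fun i => unitInterval.toNNReal i * t
  have hτ : Continuous τ := by fun_prop
  let e : N₁ × unitInterval → ℝ≥0 × Z := fun s => (τ s.2, s.1)
  have he : Continuous e := by fun_prop
  let P : Set (N₁ × unitInterval) := {s | χ.StaysIn (N₁ \ N₂) (τ s.2) s.1}
  have hPS : ∀ s ∈ P, χ.MapsIn (τ s.2) s.1 (N₁ \ N₂) := fun s hs => hs _ le_rfl
  have hP : IsOpen P := by
    convert (isOpen_staysIn (χ := χ) hN.isClosed_snd.isOpen_compl).preimage he using 1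
    ext s
    exact (hN.staysIn_compl_iff s.1.2).symm
  have hcont := continuous_ite_collapseMap (A := N₁) (B := N₂) hN.isClosed_fst
    (h := fun s : N₁ × unitInterval => χ.endpoint (τ s.2) s.1) hP
    (continuousOn_endpoint.comp (f := e) he.continuousOn fun s hs => (hPS s hs).isSome)
    (fun s hs => (hPS s hs).endpoint_mem) (fun C hC hCN => by
      convert isClosed_mapsIn (hN.isClosed_staysIn.preimage he) (hτ.comp continuous_snd)
        (continuous_subtype_val.comp continuous_fst) (fun s hs => (hs _ le_rfl).isSome) hC using 1
      ext s
      constructor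
      · rintro ⟨hs, hsC⟩
        exact ⟨hs.mono sdiff_subset, mapsIn_iff.2 ⟨(hPS s hs).isSome, hsC⟩⟩
      · rintro ⟨hs, hsC⟩
        exact ⟨hN.staysIn_diff hs (hCN hsC.endpoint_mem).2, hsC.endpoint_mem⟩)
  let G : C(N₁ × unitInterval, (quotientSpace N₁ N₂).carrier) := ⟨_, hcont⟩
  have hG : ∀ a i, G (a, i) = if χ.StaysIn (N₁ \ N₂) (τ i) a then
      collapseMap N₁ N₂ (χ.endpoint (τ i) a) else (quotientSpace N₁ N₂).pt := fun _ _ => rfl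
  -- Curried, the homotopy is a map from N₁ to a path space that is constant on N₂, so it descends
  -- to the quotient without a product of quotient maps.
  have hG0 : ∀ a : N₁, (a : Z) ∈ N₂ →
      G.curry a = ContinuousMap.const _ (quotientSpace N₁ N₂).pt := fun a ha => by
    ext i
    rw [ContinuousMap.curry_apply, hG, if_neg fun h => (mapsIn_zero.1 (h 0 zero_le)).2 ha]
    rfl
  let H : C((quotientSpace N₁ N₂).carrier, C(unitInterval, (quotientSpace N₁ N₂).carrier)) :=
    ⟨quotientLift G.curry (ContinuousMap.const _ (quotientSpace N₁ N₂).pt) hG0,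
      continuous_quotientLift G.curry.continuous⟩
  have hH : ∀ (a : N₁) i, H (collapseMap N₁ N₂ a) i = G (a, i) := fun a i => by
    have h : H (collapseMap N₁ N₂ a) = G.curry a := quotientLift_collapseMap hG0 a
    rw [h, ContinuousMap.curry_apply]
  refine ⟨H.uncurry.comp ContinuousMap.prodSwap, fun i => rfl, fun q => ?_, fun a => ?_⟩
  · change H q 0 = q
    induction q using quotientSpace_ind with
    | h a =>
      have h0 : τ 0 = 0 := by simp [τ]
      rw [hH, hG, h0, endpoint_zero]
      split_ifs with h
      · rfl
      · refine (collapseMap_eq_pt ?_).symm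
        by_contra ha
        refine h fun s hs => ?_
        rw [nonpos_iff_eq_zero.1 hs]
        exact mapsIn_zero.2 ⟨a.2, ha⟩
    | hpt => rfl
  · change H (collapseMap N₁ N₂ a) 1 = _
    have h1 : τ 1 = t := by simp [τ]
    rw [hH, hG, h1]

/-! ### The comparison maps -/

/-- The trajectory of `z` stays in `A` on `[0, 2T]` and in `B` on `[T, 3T]`. -/
def Passes (χ : LocalSemiflow Z) (A B : Set Z) (T : ℝ≥0) (z : Z) : Prop :=
  χ.StaysIn A (T + T) z ∧ χ.MapsIn T z {w | χ.StaysIn B (T + T) w}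

theorem Passes.mapsIn {A B : Set Z} {T : ℝ≥0} {z : Z} (h : χ.Passes A B T z) :
    χ.MapsIn (T + (T + T)) z B := mapsIn_staysIn_iff.1 h.2 _ le_rfl

open Classical in
theorem exists_comparison (hN : χ.IsBasicIndexPair N₁ N₂) (hM : χ.IsBasicIndexPair M₁ M₂)
    {T : ℝ≥0} (hNM : ∀ z, χ.StaysIn (N₁ \ N₂) (T + T) z → χ.MapsIn T z (M₁ \ M₂))
    (hMN : ∀ z, χ.StaysIn (M₁ \ M₂) (T + T) z → χ.MapsIn T z (N₁ \ N₂)) :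
    ∃ f : C((quotientSpace N₁ N₂).carrier, (quotientSpace M₁ M₂).carrier),
      f (quotientSpace N₁ N₂).pt = (quotientSpace M₁ M₂).pt ∧
      ∀ a : N₁, f (collapseMap N₁ N₂ a) = if χ.Passes (N₁ \ N₂) (M₁ \ M₂) T a then
        collapseMap M₁ M₂ (χ.endpoint (T + (T + T)) a) else (quotientSpace M₁ M₂).pt := by
  let P : Set N₁ := {a | χ.Passes (N₁ \ N₂) (M₁ \ M₂) T a}
  have hP : IsOpen P := by
    have c1 : Continuous fun a : N₁ => (T + T, (a : Z)) := by fun_prop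
    have c2 : Continuous fun a : N₁ => (T, (a : Z)) := by fun_prop
    have c3 : Continuous fun z : Z => (T + T, z) := by fun_prop
    have o1 := (isOpen_staysIn (χ := χ) hN.isClosed_snd.isOpen_compl).preimage c1
    have o2 := (isOpen_mapsIn (χ := χ)
      ((isOpen_staysIn (χ := χ) hM.isClosed_snd.isOpen_compl).preimage c3)).preimage c2
    convert o1.inter o2 using 1
    ext a
    constructor
    · rintro ⟨h1, h2⟩
      exact ⟨(hN.staysIn_compl_iff a.2).2 h1,
        h2.mono fun w hw => hw.mono fun _ hx => hx.2⟩
    · rintro ⟨h1, h2⟩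
      have h1' := (hN.staysIn_compl_iff a.2).1 h1
      refine ⟨h1', ?_⟩
      -- By `hNM` the point at time T is already in M₁, so from there avoiding M₂ is enough.
      have h3 := mapsIn_iff.1 (hNM _ h1')
      exact mapsIn_iff.2 ⟨h3.1, (hM.staysIn_compl_iff h3.2.1).1 h2.endpoint_mem⟩
  have hcont := continuous_ite_collapseMap (A := M₁) (B := M₂) hM.isClosed_fst
    (h := fun a : N₁ => χ.endpoint (T + (T + T)) a) hP
    (continuousOn_endpoint.comp (f := fun a : N₁ => (T + (T + T), (a : Z)))
      (by fun_prop) fun a ha => ha.mapsIn.isSome)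
    (fun a ha => ha.mapsIn.endpoint_mem) (fun C hC hCM => by
      have c1 : Continuous fun a : N₁ => (T + T, (a : Z)) := by fun_prop
      have c3 : Continuous fun z : Z => (T + T, z) := by fun_prop
      have k1 := hN.isClosed_staysIn.preimage c1
      have k2 := isClosed_mapsIn k1 (continuous_const (y := T)) continuous_subtype_val
        (fun a ha => (ha T le_self_add).isSome) (hM.isClosed_staysIn.preimage c3)
      have k3 := isClosed_mapsIn k2 (continuous_const (y := T + (T + T))) continuous_subtype_val
        (fun a ha => (mapsIn_staysIn_iff.1 ha.2 _ le_rfl).isSome) hC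
      convert k3 using 1
      ext a
      constructor
      · rintro ⟨ha, haC⟩
        exact ⟨⟨ha.1.mono sdiff_subset, ha.2.mono fun w hw => hw.mono sdiff_subset⟩,
          mapsIn_iff.2 ⟨ha.mapsIn.isSome, haC⟩⟩
      · rintro ⟨⟨h1, v, hv, h2⟩, h3⟩
        -- The endpoint avoids M₂, hence so does the segment on [T, 3T]. Its midpoint, at time 2T,
        -- is in N₁ \ N₂ by `hMN`, so the segment on [0, 2T] avoids N₂.
        have h4 : χ.StaysIn (M₁ \ M₂) (T + T) v :=
          hM.staysIn_diff h2 (hCM ((mapsIn_add hv).1 h3).endpoint_mem).2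
        refine ⟨⟨hN.staysIn_diff h1 ?_, v, hv, h4⟩, h3.endpoint_mem⟩
        exact ((mapsIn_add hv).2 (hMN v h4)).endpoint_mem.2)
  have hpt : ∀ a : N₁, (a : Z) ∈ N₂ → (if a ∈ P then
      collapseMap M₁ M₂ (χ.endpoint (T + (T + T)) a) else (quotientSpace M₁ M₂).pt) =
        (quotientSpace M₁ M₂).pt :=
    fun a ha => if_neg fun h => (mapsIn_zero.1 (h.1 0 zero_le)).2 ha
  exact ⟨⟨quotientLift _ (quotientSpace M₁ M₂).pt hpt, continuous_quotientLift hcont⟩, rfl,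
    fun a => quotientLift_collapseMap hpt a⟩

/-- The two passages ask for A on [0, 2T] and [4T, 6T] and for B on [T, 5T]. The latter supplies A
on the gap [2T, 4T]; conversely, A on [0, 6T] supplies B on [T, 5T]. -/
theorem passes_and_passes_iff {A B : Set Z} {T : ℝ≥0}
    (hAB : ∀ z, χ.StaysIn A (T + T) z → χ.MapsIn T z B)
    (hBA : ∀ z, χ.StaysIn B (T + T) z → χ.MapsIn T z A) {z : Z} :
    (χ.Passes A B T z ∧ χ.Passes B A T (χ.endpoint (T + (T + T)) z)) ↔
      χ.StaysIn A ((T + (T + T)) + (T + (T + T))) z := by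
  have shift : ∀ {A B : Set Z}, (∀ z, χ.StaysIn A (T + T) z → χ.MapsIn T z B) → ∀ a,
      (∀ s, a ≤ s → s ≤ a + (T + T) → χ.MapsIn s z A) → χ.MapsIn (a + T) z B := by
    intro A B h a ha
    rw [mapsIn_add_iff]
    obtain ⟨v, hv, hvA⟩ := mapsIn_staysIn_iff.2
      fun s (hs : s ≤ T + T) => ha (a + s) le_self_add (by gcongr)
    exact ⟨v, hv, h v hvA⟩
  constructor
  · rintro ⟨h1, h2⟩
    have hv := toFun_eq_endpoint h1.mapsIn.isSome
    have hB : ∀ s, T ≤ s → s ≤ T + (T + (T + T)) + T → χ.MapsIn s z B := by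
      intro s hs hs'
      rcases le_total s (T + (T + T)) with h | h
      · obtain ⟨b, rfl⟩ := exists_add_of_le hs
        exact mapsIn_staysIn_iff.1 h1.2 b (le_of_add_le_add_left h)
      · obtain ⟨b, rfl⟩ := exists_add_of_le h
        refine (mapsIn_add hv).2 (h2.1 b ?_)
        rw [← NNReal.coe_le_coe] at hs' ⊢
        push_cast at hs' ⊢
        linarith
    intro s hs
    rcases le_total s (T + T) with h | h
    · exact h1.1 s h
    rcases le_total s (T + (T + (T + T))) with h' | h'
    · obtain ⟨b, rfl⟩ := exists_add_of_le h
      rw [add_right_comm]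
      refine shift hBA _ fun s h1 h2 => hB s (le_self_add.trans h1) (h2.trans ?_)
      rw [← NNReal.coe_le_coe] at h' ⊢
      push_cast at h' ⊢
      linarith
    · obtain ⟨b, rfl⟩ := exists_add_of_le h'
      have h3 := mapsIn_staysIn_iff.1 h2.2 b (by
        rw [← NNReal.coe_le_coe] at hs ⊢
        push_cast at hs ⊢
        linarith)
      have h4 := (mapsIn_add hv).2 h3
      convert h4 using 1
      ring
  · intro h
    have hB : ∀ s, T ≤ s → s ≤ T + (T + (T + T)) + T → χ.MapsIn s z B := by
      intro s hs hs'
      obtain ⟨b, rfl⟩ := exists_add_of_le hs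
      rw [add_comm]
      refine shift hAB _ fun s h1 h2 => h s (h2.trans ?_)
      rw [← NNReal.coe_le_coe] at hs' ⊢
      push_cast at hs' ⊢
      linarith
    have hP : χ.Passes A B T z := by
      refine ⟨fun s hs => h s (hs.trans ?_), mapsIn_staysIn_iff.2 fun s hs =>
        hB _ le_self_add ?_⟩
      · rw [← NNReal.coe_le_coe]
        push_cast
        linarith [T.coe_nonneg]
      · rw [← NNReal.coe_le_coe] at hs ⊢
        push_cast at hs ⊢
        linarith [T.coe_nonneg]
    have hv := toFun_eq_endpoint hP.mapsIn.isSome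
    refine ⟨hP, fun s hs => (mapsIn_add hv).1 (hB _ ?_ ?_), mapsIn_staysIn_iff.2 fun s hs =>
      (mapsIn_add hv).1 (h _ ?_)⟩
    · exact le_self_add.trans le_self_add
    all_goals
      rw [← NNReal.coe_le_coe] at hs ⊢
      push_cast at hs ⊢
      linarith [T.coe_nonneg]

/-- The composite agrees with the end of the homotopy of `exists_homotopy` for time 6T. -/
theorem homotopicRel_of_comparison (hN : χ.IsBasicIndexPair N₁ N₂) {T : ℝ≥0}
    (hNM : ∀ z, χ.StaysIn (N₁ \ N₂) (T + T) z → χ.MapsIn T z (M₁ \ M₂))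
    (hMN : ∀ z, χ.StaysIn (M₁ \ M₂) (T + T) z → χ.MapsIn T z (N₁ \ N₂))
    {f : C((quotientSpace N₁ N₂).carrier, (quotientSpace M₁ M₂).carrier)}
    {g : C((quotientSpace M₁ M₂).carrier, (quotientSpace N₁ N₂).carrier)}
    (hf0 : f (quotientSpace N₁ N₂).pt = (quotientSpace M₁ M₂).pt)
    (hg0 : g (quotientSpace M₁ M₂).pt = (quotientSpace N₁ N₂).pt)
    (hf : open Classical in
      ∀ a : N₁, f (collapseMap N₁ N₂ a) = if χ.Passes (N₁ \ N₂) (M₁ \ M₂) T a then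
        collapseMap M₁ M₂ (χ.endpoint (T + (T + T)) a) else (quotientSpace M₁ M₂).pt)
    (hg : open Classical in
      ∀ a : M₁, g (collapseMap M₁ M₂ a) = if χ.Passes (M₁ \ M₂) (N₁ \ N₂) T a then
        collapseMap N₁ N₂ (χ.endpoint (T + (T + T)) a) else (quotientSpace N₁ N₂).pt) :
    (g.comp f).HomotopicRel (ContinuousMap.id _) {(quotientSpace N₁ N₂).pt} := by
  classical
  obtain ⟨F, hFpt, hF0, hF1⟩ := hN.exists_homotopy ((T + (T + T)) + (T + (T + T)))
  have hF1' : ∀ q, F (1, q) = g (f q) := by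
    intro q
    induction q using quotientSpace_ind with
    | h a =>
      rw [hF1, hf]
      by_cases h1 : χ.Passes (N₁ \ N₂) (M₁ \ M₂) T a
      · have hM1 : χ.endpoint (T + (T + T)) a ∈ M₁ := h1.mapsIn.endpoint_mem.1
        rw [if_pos h1, hg ⟨_, hM1⟩]
        have h3 := passes_and_passes_iff hNM hMN (z := (a : Z))
        rw [and_iff_right h1] at h3
        by_cases h2 : χ.StaysIn (N₁ \ N₂) ((T + (T + T)) + (T + (T + T))) a
        · rw [if_pos h2, if_pos (h3.2 h2), (h2 _ le_rfl).endpoint_add]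
        · rw [if_neg h2, if_neg fun h => h2 (h3.1 h)]
      · rw [if_neg h1, hg0, if_neg]
        rw [← passes_and_passes_iff hNM hMN]
        exact fun h => h1 h.1
    | hpt => rw [hFpt, hf0, hg0]
  refine (ContinuousMap.HomotopicRel.symm ⟨⟨⟨F, hF0, hF1'⟩, ?_⟩⟩)
  rintro i q rfl
  exact hFpt i

theorem pointedHomotopyEquivalent_of_staysIn (hN : χ.IsBasicIndexPair N₁ N₂)
    (hM : χ.IsBasicIndexPair M₁ M₂) {T : ℝ≥0}
    (hNM : ∀ z, χ.StaysIn (N₁ \ N₂) (T + T) z → χ.MapsIn T z (M₁ \ M₂))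
    (hMN : ∀ z, χ.StaysIn (M₁ \ M₂) (T + T) z → χ.MapsIn T z (N₁ \ N₂)) :
    PointedHomotopyEquivalent (quotientSpace N₁ N₂) (quotientSpace M₁ M₂) := by
  obtain ⟨f, hf0, hf⟩ := exists_comparison hN hM hNM hMN
  obtain ⟨g, hg0, hg⟩ := exists_comparison hM hN hMN hNM
  exact ⟨f, g, hf0, hg0, homotopicRel_of_comparison hN hNM hMN hf0 hg0 hf hg,
    homotopicRel_of_comparison hM hMN hNM hg0 hf0 hg hf⟩

end LocalSemiflow

/-! ### Independence of the index pair -/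

namespace SkewProductSemiflow

theorem IsIndexPair.pointedHomotopyEquivalent {X : Type*} {Y : Type*} [TopologicalSpace X]
    [TopologicalSpace Y] [T2Space X] [T2Space Y] {π : SkewProductSemiflow Y X} {y₀ : Y}
    {K : Set (Y × X)} {N₁ N₂ M₁ M₂ : Set (ℝ≥0 × X)} (hN : π.IsIndexPair y₀ K N₁ N₂)
    (hM : π.IsIndexPair y₀ K M₁ M₂) :
    PointedHomotopyEquivalent (quotientSpace N₁ N₂) (quotientSpace M₁ M₂) := by
  obtain ⟨T, hT⟩ := π.exists_forall_mapsIn_of_staysIn y₀ hN hM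
  obtain ⟨T', hT'⟩ := π.exists_forall_mapsIn_of_staysIn y₀ hM hN
  -- Both comparison maps must use the same T, hence the maximum of the two thresholds.
  exact LocalSemiflow.pointedHomotopyEquivalent_of_staysIn hN.isBasicIndexPair
    hM.isBasicIndexPair (hT (max T T') (le_max_left _ _)) (hT' (max T T') (le_max_right _ _))

end SkewProductSemiflow

end NonautonomousConley

open NonautonomousConley
theorem mainTheorem2 {X : Type*} {Y : Type*} [MetricSpace X] [MetricSpace Y]
    (π : SkewProductSemiflow Y X) (y₀ : Y) (K : Set (Y × X)) :
    (∀ N₁ N₂ M₁ M₂ : Set (ℝ≥0 × X), π.IsIndexPair y₀ K N₁ N₂ → π.IsIndexPair y₀ K M₁ M₂ →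
      PointedHomotopyEquivalent (quotientSpace N₁ N₂) (quotientSpace M₁ M₂)) ∧
    ((∃ N₁ N₂ : Set (ℝ≥0 × X), π.IsIndexPair y₀ K N₁ N₂) →
      ∃! h : PointedHomotopyType, ∀ N₁ N₂ : Set (ℝ≥0 × X), π.IsIndexPair y₀ K N₁ N₂ →
        pointedHomotopyType (quotientSpace N₁ N₂) = h) := by
  refine ⟨fun N₁ N₂ M₁ M₂ hN hM => hN.pointedHomotopyEquivalent hM, ?_⟩
  rintro ⟨N₁, N₂, hN⟩
  exact ⟨pointedHomotopyType (quotientSpace N₁ N₂),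
    fun M₁ M₂ hM => Quotient.sound (hM.pointedHomotopyEquivalent hN),
    fun h hh => (hh N₁ N₂ hN).symm⟩
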